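/- Let $M$ be a parallelizable smooth manifold of dimension $m$ (Hausdorff, $\sigma$-compact, without boundary), let $n\ge 1$, let $C^\infty(M)$ be the algebra of complex-valued smooth functions on $M$, and let $A=C^\infty(M)\otimes M_n(\mathbb C)$. Let $\mathrm{Der}\,A$ be the $Z(A)$-module of $\mathbb C$-linear derivations of $A$ and let $A^1=\mathrm{Hom}_{Z(A)}(\mathrm{Der}\,A,A)$ with the bimodule structure $(a\alpha b)(X)=a\,\alpha(X)\,b$ and the differential $d:A\to A^1$, $(da)(X)=X(a)$. Fix a global smooth frame $V_1,\dots,V_m$ of $TM$ and a basis $\lambda_1,\dots,\lambda_{n^2-1}$ of the traceless matrices $\mathfrak{sl}_n(\mathbb C)$. Let $(e_i)_{1\le i\le m+n^2-1}$ be the derivations of $A$ consisting of the $V_\alpha$, acting on each matrix entry, and of the inner derivations $a\mapsto[\lambda_s,a]$. Then there is exactly one family $(\theta^i)$ in $A^1$ with $\theta^i(e_j)=\delta^i_j$ for all $i,j$, and there is exactly one bimodule automorphism $\sigma$ of $A^1\otimes_A A^1$ with $(\sigma t)(X,Y)=t(Y,X)$ for all $t\in A^1\otimes_AA^1$ and $X,Y\in\mathrm{Der}\,A$,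 where $(\alpha\otimes_A\beta)(X,Y)=\alpha(X)\beta(Y)$. Let $\nabla^L:A^1\to A^1\otimes_A A^1$ be a left connection and $\nabla^R:A^1\to A^1\otimes_A A^1$ a right connection, i.e. $\mathbb C$-linear maps with $\nabla^L(a\zeta)=da\otimes_A\zeta+a\nabla^L\zeta$ and $\nabla^R(\zeta a)=(\nabla^R\zeta)a+\zeta\otimes_A da$ for all $a\in A$, $\zeta\in A^1$. There are unique Christoffel symbols $\Gamma^i_{jk},\widetilde\Gamma^i_{jk}\in A$ with $$\nabla^L\theta^i=\sum_{j,k}\theta^j\otimes_A\theta^k\,\Gamma^i_{jk},\qquad \nabla^R\theta^i=\sum_{j,k}\theta^j\otimes_A\theta^k\,\widetilde\Gamma^i_{jk},$$ and the following hold. 1. The pair $(\nabla^L,\nabla^R)$ is $\sigma$-compatible, i.e. $\nabla^L\zeta=\sigma(\nabla^R\zeta)$ for all $\zeta$ in the centre $Z(A^1)=\{\zeta\in A^1: a\zeta=\zeta a\ \text{for all } a\in A\}$, if and only if $\widetilde\Gamma^i_{kj}=\Gamma^i_{jk}$ for all $i,j,k$. 2. The pair is $\sigma$-compatible on the whole bimodule,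 i.e. $\nabla^L\zeta=\sigma(\nabla^R\zeta)$ for all $\zeta\in A^1$, if and only if $\widetilde\Gamma^i_{kj}=\Gamma^i_{jk}\in C^\infty(M)$ for all $i,j,k$, where $C^\infty(M)$ is regarded as the subalgebra $C^\infty(M)\otimes 1$ of $A$. -/

import Mathlib

open scoped Manifold ContDiff TensorProduct
open MulOpposite (op)

set_option linter.unusedSectionVars false

noncomputable section

namespace MatrixGeometry

/-! ## Bimodules over a noncommutative algebra

An `A`-bimodule `E` is a left `A`-module and a left `Aᵐᵒᵖ`-module with commuting actions; the
product `ζ a` is written `op a • ζ`. -/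

section Bimodule

variable (k A : Type*) [CommRing k] [Ring A] [Algebra k A]
variable (E F : Type*) [AddCommGroup E] [AddCommGroup F] [Module k E] [Module k F]
variable [Module A E] [Module Aᵐᵒᵖ E] [SMulCommClass A Aᵐᵒᵖ E] [SMulCommClass A k E]
  [SMulCommClass Aᵐᵒᵖ k E]
variable [Module A F] [Module Aᵐᵒᵖ F] [SMulCommClass A Aᵐᵒᵖ F] [SMulCommClass A k F]
  [SMulCommClass Aᵐᵒᵖ k F]

/-- The relations `ζ a ⊗ ρ = ζ ⊗ a ρ` in `E ⊗[k] F`. -/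
def balancingRelations : Submodule k (E ⊗[k] F) :=
  Submodule.span k {t | ∃ (ζ : E) (a : A) (ρ : F), t = (op a • ζ) ⊗ₜ[k] ρ - ζ ⊗ₜ[k] (a • ρ)}

/-- The tensor product `E ⊗_A F` over the (noncommutative) algebra `A`. -/
def BalTensor : Type _ := (E ⊗[k] F) ⧸ balancingRelations k A E F

instance : AddCommGroup (BalTensor k A E F) :=
  inferInstanceAs (AddCommGroup ((E ⊗[k] F) ⧸ balancingRelations k A E F))

instance : Module k (BalTensor k A E F) :=
  inferInstanceAs (Module k ((E ⊗[k] F) ⧸ balancingRelations k A E F))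

variable {E F} in
/-- The pure tensor `ζ ⊗_A ρ`. -/
def btmul (ζ : E) (ρ : F) : BalTensor k A E F :=
  (balancingRelations k A E F).mkQ (ζ ⊗ₜ[k] ρ)

/-- Multiplication by `a` on the left of `E ⊗_A F`. -/
def lact (a : A) : BalTensor k A E F →ₗ[k] BalTensor k A E F :=
  (balancingRelations k A E F).mapQ (balancingRelations k A E F)
    (TensorProduct.map (Module.toModuleEnd k (S := A) E a) LinearMap.id) (by
      rw [balancingRelations, Submodule.span_le]
      rintro _ ⟨ζ, b, ρ, rfl⟩
      refine Submodule.subset_span ⟨a • ζ, b, ρ, ?_⟩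
      simp [smul_comm a (op b) ζ])

/-- Multiplication by `a` on the right of `E ⊗_A F`. -/
def ract (a : Aᵐᵒᵖ) : BalTensor k A E F →ₗ[k] BalTensor k A E F :=
  (balancingRelations k A E F).mapQ (balancingRelations k A E F)
    (TensorProduct.map LinearMap.id (Module.toModuleEnd k (S := Aᵐᵒᵖ) F a)) (by
      rw [balancingRelations, Submodule.span_le]
      rintro _ ⟨ζ, b, ρ, rfl⟩
      refine Submodule.subset_span ⟨ζ, b, a • ρ, ?_⟩
      simp [smul_comm b a ρ])

variable {k A E F} in
theorem BalTensor.hom_ext {f g : BalTensor k A E F →ₗ[k] BalTensor k A E F}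
    (h : ∀ ζ ρ, f (btmul k A ζ ρ) = g (btmul k A ζ ρ)) : f = g := by
  refine Submodule.linearMap_qext _ (TensorProduct.ext' fun ζ ρ => h ζ ρ)

theorem lact_btmul (a : A) (ζ : E) (ρ : F) :
    lact k A E F a (btmul k A ζ ρ) = btmul k A (a • ζ) ρ := rfl

theorem ract_btmul (a : Aᵐᵒᵖ) (ζ : E) (ρ : F) :
    ract k A E F a (btmul k A ζ ρ) = btmul k A ζ (a • ρ) := rfl

theorem btmul_add_left (ζ ζ' : E) (ρ : F) :
    btmul k A (ζ + ζ') ρ = btmul k A ζ ρ + btmul k A ζ' ρ := by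
  simp [btmul, TensorProduct.add_tmul]; rfl

theorem btmul_add_right (ζ : E) (ρ ρ' : F) :
    btmul k A ζ (ρ + ρ') = btmul k A ζ ρ + btmul k A ζ ρ' := by
  simp [btmul, TensorProduct.tmul_add]; rfl

theorem btmul_zero_left (ρ : F) : btmul k A (0 : E) ρ = 0 := by
  simp [btmul, TensorProduct.zero_tmul]; rfl

theorem btmul_zero_right (ζ : E) : btmul k A ζ (0 : F) = 0 := by
  simp [btmul, TensorProduct.tmul_zero]; rfl

/-- The left `A`-module structure of `E ⊗_A F`, with `a (ζ ⊗_A ρ) = a ζ ⊗_A ρ`. -/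
instance : Module A (BalTensor k A E F) :=
  Module.compHom (R := Module.End k (BalTensor k A E F)) (BalTensor k A E F)
    { toFun := lact k A E F
      map_one' := BalTensor.hom_ext fun ζ ρ => by simp [lact_btmul]
      map_mul' := fun a b => BalTensor.hom_ext fun ζ ρ => by simp [lact_btmul, mul_smul]
      map_zero' := BalTensor.hom_ext fun ζ ρ => by simp [lact_btmul, btmul_zero_left]
      map_add' := fun a b => BalTensor.hom_ext fun ζ ρ => by
        simp [lact_btmul, add_smul, btmul_add_left] }

/-- The right `A`-module structure of `E ⊗_A F`, with `(ζ ⊗_A ρ) a = ζ ⊗_A ρ a`. -/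
instance : Module Aᵐᵒᵖ (BalTensor k A E F) :=
  Module.compHom (R := Module.End k (BalTensor k A E F)) (BalTensor k A E F)
    { toFun := ract k A E F
      map_one' := BalTensor.hom_ext fun ζ ρ => by simp [ract_btmul]
      map_mul' := fun a b => BalTensor.hom_ext fun ζ ρ => by simp [ract_btmul, mul_smul]
      map_zero' := BalTensor.hom_ext fun ζ ρ => by simp [ract_btmul, btmul_zero_right]
      map_add' := fun a b => BalTensor.hom_ext fun ζ ρ => by
        simp [ract_btmul, add_smul, btmul_add_right] }

theorem smul_btmul (a : A) (ζ : E) (ρ : F) :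
    a • btmul k A ζ ρ = btmul k A (a • ζ) ρ := rfl

theorem op_smul_btmul (a : A) (ζ : E) (ρ : F) :
    op a • btmul k A ζ ρ = btmul k A ζ (op a • ρ) := rfl

/-- The linear map on `E ⊗_A F` given by a balanced bilinear map on `E × F`. -/
def balLift {G : Type*} [AddCommGroup G] [Module k G] (f : E →ₗ[k] F →ₗ[k] G)
    (hf : ∀ ζ (a : A) ρ, f (op a • ζ) ρ = f ζ (a • ρ)) : BalTensor k A E F →ₗ[k] G :=
  (balancingRelations k A E F).liftQ (TensorProduct.lift f) (by
    rw [balancingRelations, Submodule.span_le]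
    rintro _ ⟨ζ, a, ρ, rfl⟩
    simp [hf])

theorem btmul_balanced (a : A) (ζ : E) (ρ : F) :
    btmul k A (op a • ζ) ρ = btmul k A ζ (a • ρ) := by
  refine (Submodule.Quotient.eq _).2 (Submodule.subset_span ⟨ζ, a, ρ, rfl⟩)

end Bimodule

/-! ## Connections and `σ`-compatibility -/

section Connection

variable {k A : Type*} [CommRing k] [Ring A] [Algebra k A]
variable {Ω : Type*} [AddCommGroup Ω] [Module k Ω]
variable [Module A Ω] [Module Aᵐᵒᵖ Ω] [SMulCommClass A Aᵐᵒᵖ Ω] [SMulCommClass A k Ω]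
  [SMulCommClass Aᵐᵒᵖ k Ω]
variable (d : A →ₗ[k] Ω)
variable (E : Type*) [AddCommGroup E] [Module k E]
variable [Module A E] [Module Aᵐᵒᵖ E] [SMulCommClass A Aᵐᵒᵖ E] [SMulCommClass A k E]
  [SMulCommClass Aᵐᵒᵖ k E]

/-- A left connection on the bimodule `E` with respect to the differential `d : A → Ω`. -/
structure LeftConnection where
  toLinearMap : E →ₗ[k] BalTensor k A Ω E
  leibniz : ∀ (a : A) (ζ : E),
    toLinearMap (a • ζ) = btmul k A (d a) ζ + a • toLinearMap ζ

/-- A right connection on the bimodule `E` with respect to the differential `d : A → Ω`. -/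
structure RightConnection where
  toLinearMap : E →ₗ[k] BalTensor k A E Ω
  leibniz : ∀ (a : A) (ζ : E),
    toLinearMap (op a • ζ) = op a • toLinearMap ζ + btmul k A ζ (d a)

/-- An isomorphism of `A`-bimodules `E ⊗_A Ω → Ω ⊗_A E`. -/
structure BimoduleIso (k A Ω E : Type*) [CommRing k] [Ring A] [Algebra k A]
    [AddCommGroup Ω] [Module k Ω] [Module A Ω] [Module Aᵐᵒᵖ Ω] [SMulCommClass A Aᵐᵒᵖ Ω]
    [SMulCommClass A k Ω] [SMulCommClass Aᵐᵒᵖ k Ω]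
    [AddCommGroup E] [Module k E] [Module A E] [Module Aᵐᵒᵖ E] [SMulCommClass A Aᵐᵒᵖ E]
    [SMulCommClass A k E] [SMulCommClass Aᵐᵒᵖ k E] where
  toEquiv : BalTensor k A E Ω ≃ₗ[k] BalTensor k A Ω E
  map_left : ∀ (a : A) (t : BalTensor k A E Ω), toEquiv (a • t) = a • toEquiv t
  map_right : ∀ (a : A) (t : BalTensor k A E Ω), toEquiv (op a • t) = op a • toEquiv t

variable {d E}

/-- `(∇ᴸ, ∇ᴿ)` is `σ`-compatible: `∇ᴸ ζ = σ (∇ᴿ ζ)` for all `ζ` in the centre of `E`. -/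
def IsSigmaCompatible (σ : BimoduleIso k A Ω E) (L : LeftConnection d E)
    (R : RightConnection d E) : Prop :=
  ∀ ζ : E, (∀ a : A, a • ζ = op a • ζ) → L.toLinearMap ζ = σ.toEquiv (R.toLinearMap ζ)

/-- `(∇ᴸ, ∇ᴿ)` is `σ`-compatible on the whole bimodule. -/
def IsSigmaCompatibleOnWhole (σ : BimoduleIso k A Ω E) (L : LeftConnection d E)
    (R : RightConnection d E) : Prop :=
  ∀ ζ : E, L.toLinearMap ζ = σ.toEquiv (R.toLinearMap ζ)

end Connection

/-! ## The derivation based calculus -/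

section Derivations

variable (k A : Type*) [CommRing k] [Ring A] [Algebra k A]

instance centerSMulComm : SMulCommClass (Subalgebra.center k A) A A where
  smul_comm z a b := by
    have h := (Subalgebra.mem_center_iff.1 z.2) a
    simp only [Subalgebra.smul_def, smul_eq_mul]
    rw [← mul_assoc, ← mul_assoc, h]

instance smulCommCenter : SMulCommClass A (Subalgebra.center k A) A := SMulCommClass.symm _ _ _

/-- `Der A`, the `k`-linear derivations of the algebra `A`, as a module over the centre of `A`. -/
def Der : Submodule (Subalgebra.center k A) (A →ₗ[k] A) where
  carrier := {D | ∀ a b, D (a * b) = D a * b + a * D b}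
  zero_mem' := by intro a b; simp
  add_mem' := by
    intro D D' h h' a b
    simp only [LinearMap.add_apply, h a b, h' a b]
    noncomm_ring
  smul_mem' := by
    intro z D h a b
    have hz := (Subalgebra.mem_center_iff.1 z.2) a
    simp only [LinearMap.smul_apply, h a b, Subalgebra.smul_def, smul_eq_mul, mul_add]
    rw [← mul_assoc, ← mul_assoc, ← mul_assoc, hz]

/-- The one-forms `A¹ = Hom_{Z(A)}(Der A, A)`. The bimodule structure is the pointwise one:
`(a α)(X) = a α(X)` and `(α a)(X) = α(X) a`. -/
abbrev OneForms : Type _ := Der k A →ₗ[Subalgebra.center k A] A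

/-- The differential `d : A → A¹`, `(d a)(X) = X a`. -/
def diff : A →ₗ[k] OneForms k A where
  toFun a :=
    { toFun := fun X => (X : A →ₗ[k] A) a
      map_add' := fun _ _ => rfl
      map_smul' := fun _ _ => rfl }
  map_add' a b := by ext X; simp
  map_smul' c a := by ext X; simp

/-- The bilinear map `(α, β) ↦ ((X, Y) ↦ α(X) β(Y))`. -/
def evalPair : OneForms k A →ₗ[k] OneForms k A →ₗ[k] (Der k A → Der k A → A) :=
  LinearMap.mk₂ k (fun α β X Y => α X * β Y)
    (fun α α' β => by funext X Y; exact add_mul _ _ _)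
    (fun c α β => by funext X Y; exact smul_mul_assoc c (α X) (β Y))
    (fun α β β' => by funext X Y; exact mul_add _ _ _)
    (fun c α β => by funext X Y; exact mul_smul_comm c (α X) (β Y))

/-- The evaluation `(α ⊗_A β)(X, Y) = α(X) β(Y)` of elements of `A¹ ⊗_A A¹` on derivations. -/
def evalTwo : BalTensor k A (OneForms k A) (OneForms k A) →ₗ[k] (Der k A → Der k A → A) :=
  balLift k A (OneForms k A) (OneForms k A) (evalPair k A) fun α a β => by
    funext X Y
    exact mul_assoc (α X) a (β Y)

theorem evalTwo_btmul (α β : OneForms k A) (X Y : Der k A) :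
    evalTwo k A (btmul k A α β) X Y = α X * β Y := rfl

/-- Left connections on the bimodule `A¹`. -/
abbrev LeftConn : Type _ := LeftConnection (diff k A) (OneForms k A)

/-- Right connections on the bimodule `A¹`. -/
abbrev RightConn : Type _ := RightConnection (diff k A) (OneForms k A)

/-- Bimodule automorphisms of `A¹ ⊗_A A¹`. -/
abbrev FormsIso : Type _ := BimoduleIso k A (OneForms k A) (OneForms k A)

/-- `σ` is the automorphism of `A¹ ⊗_A A¹` that interchanges the two arguments:
`(σ t)(X, Y) = t(Y, X)`. -/
def IsFlip (σ : FormsIso k A) : Prop :=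
  ∀ t X Y, evalTwo k A (σ.toEquiv t) X Y = evalTwo k A t Y X

variable {k A}

/-- `{θ^i}` is the family of one-forms dual to the derivations `{e_j}`: `θ^i(e_j) = δ^i_j`. -/
def IsDual {ι : Type*} [DecidableEq ι]
    (θ : ι → OneForms k A) (e : ι → Der k A) : Prop :=
  ∀ i j, θ i (e j) = if i = j then 1 else 0

/-- The element `∑_{j,k} θ^j ⊗_A θ^k G_{jk}` of `A¹ ⊗_A A¹`. -/
def tensorSum {ι : Type*} [Fintype ι]
    (θ : ι → OneForms k A) (G : ι → ι → A) : BalTensor k A (OneForms k A) (OneForms k A) :=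
  ∑ i, ∑ j, btmul k A (θ i) (op (G i j) • θ j)

/-- `Γ` are the Christoffel symbols of the left connection `L`:
`∇ᴸ θ^i = θ^j ⊗_A θ^k Γ^i_{jk}`; here `Γ i j k` is `Γ^i_{jk}`. -/
def IsLeftChristoffel {ι : Type*} [Fintype ι]
    (θ : ι → OneForms k A) (L : LeftConn k A)
    (Γ : ι → ι → ι → A) : Prop :=
  ∀ i, L.toLinearMap (θ i) = tensorSum θ (Γ i)

/-- `Γ` are the Christoffel symbols of the right connection `R`:
`∇ᴿ θ^i = θ^j ⊗_A θ^k Γ^i_{jk}`; here `Γ i j k` is `Γ^i_{jk}`. -/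
def IsRightChristoffel {ι : Type*} [Fintype ι]
    (θ : ι → OneForms k A) (R : RightConn k A)
    (Γ : ι → ι → ι → A) : Prop :=
  ∀ i, R.toLinearMap (θ i) = tensorSum θ (Γ i)

end Derivations

/-! ## Matrix valued functions on a manifold -/

section MatrixFunctions

variable (m : ℕ) (M : Type*) [TopologicalSpace M] [ChartedSpace (EuclideanSpace ℝ (Fin m)) M]

/-- `C^∞(M)`: the algebra of complex valued smooth functions on `M`. -/
def Smooth : Subalgebra ℂ (M → ℂ) where
  carrier := {f | ContMDiff (𝓡 m) 𝓘(ℝ, ℂ) ∞ f}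
  mul_mem' := fun {f g} (hf : ContMDiff _ _ _ f) (hg : ContMDiff _ _ _ g) => by
    have h : ContMDiff 𝓘(ℝ, ℂ × ℂ) 𝓘(ℝ, ℂ) ∞ (fun p : ℂ × ℂ => p.1 * p.2) :=
      (contDiff_fst.mul contDiff_snd).contMDiff
    exact h.comp (hf.prodMk_space hg)
  add_mem' := fun {f g} (hf : ContMDiff _ _ _ f) (hg : ContMDiff _ _ _ g) => by
    have h : ContMDiff 𝓘(ℝ, ℂ × ℂ) 𝓘(ℝ, ℂ) ∞ (fun p : ℂ × ℂ => p.1 + p.2) :=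
      (contDiff_fst.add contDiff_snd).contMDiff
    exact h.comp (hf.prodMk_space hg)
  algebraMap_mem' := fun _ => contMDiff_const

/-- `A = C^∞(M) ⊗ M_n(ℂ)`, as the algebra of `n × n` matrices over `C^∞(M)`. -/
abbrev MatFun (n : ℕ) : Type _ := Matrix (Fin n) (Fin n) (Smooth m M)

variable {m M}

theorem hasMFDerivAt_smooth (f : Smooth m M) (x : M) :
    HasMFDerivAt (𝓡 m) 𝓘(ℝ, ℂ) f.1 x (mfderiv (𝓡 m) 𝓘(ℝ, ℂ) f.1 x) :=
  ((f.2 : ContMDiff (𝓡 m) 𝓘(ℝ, ℂ) ∞ f.1).mdifferentiable (by simp) x).hasMFDerivAt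

theorem contMDiff_fieldDeriv [IsManifold (𝓡 m) ∞ M] (V : (x : M) → TangentSpace (𝓡 m) x)
    (hV : ContMDiff (𝓡 m) (𝓡 m).tangent ∞
      (fun x => (⟨x, V x⟩ : TangentBundle (𝓡 m) M))) (f : Smooth m M) :
    ContMDiff (𝓡 m) 𝓘(ℝ, ℂ) ∞ (fun x => mfderiv (𝓡 m) 𝓘(ℝ, ℂ) f.1 x (V x)) := by
  have h1 := (f.2 : ContMDiff (𝓡 m) 𝓘(ℝ, ℂ) ∞ f.1).contMDiff_tangentMap (m := ∞) (by simp)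
  exact (contMDiff_snd_tangentBundle_modelSpace ℂ 𝓘(ℝ, ℂ)).comp (h1.comp hV)

/-- The derivation of `C^∞(M)` given by a smooth vector field `V`: `(V f)(x) = df_x (V x)`. -/
def fieldDeriv [IsManifold (𝓡 m) ∞ M] (V : (x : M) → TangentSpace (𝓡 m) x)
    (hV : ContMDiff (𝓡 m) (𝓡 m).tangent ∞
      (fun x => (⟨x, V x⟩ : TangentBundle (𝓡 m) M))) :
    Derivation ℂ (Smooth m M) (Smooth m M) :=
  Derivation.mk'
    { toFun := fun f => ⟨fun x => mfderiv (𝓡 m) 𝓘(ℝ, ℂ) f.1 x (V x), contMDiff_fieldDeriv V hV f⟩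
      map_add' := fun f g => Subtype.ext (funext fun x => by
        have h := (hasMFDerivAt_smooth f x).add (hasMFDerivAt_smooth g x)
        exact congrArg (fun T => T (V x)) h.mfderiv)
      map_smul' := fun c f => Subtype.ext (funext fun x => by
        have h := (hasMFDerivAt_const (I := 𝓡 m) (I' := 𝓘(ℝ, ℂ)) c x).mul
          (hasMFDerivAt_smooth f x)
        have h' := congrArg (fun T => T (V x)) h.mfderiv
        refine h'.trans ?_
        have key : ∀ u : ℂ, c * u + f.1 x * 0 = c * u := fun u => by rw [mul_zero, add_zero]
        exact key _) }
    (fun f g => Subtype.ext (funext fun x => by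
        have h := (hasMFDerivAt_smooth f x).mul (hasMFDerivAt_smooth g x)
        exact congrArg (fun T => T (V x)) h.mfderiv))

/-- A derivation of `C^∞(M)` acting entrywise on matrix valued functions. -/
def entrywise (n : ℕ) (D : Derivation ℂ (Smooth m M) (Smooth m M)) : Der ℂ (MatFun m M n) :=
  ⟨(D : Smooth m M →ₗ[ℂ] Smooth m M).mapMatrix, by
    intro a b
    ext i j : 1
    simp [Matrix.mul_apply, Finset.sum_add_distrib, mul_comm, add_comm]⟩

/-- The inner derivation `a ↦ [Λ, a]` for a constant matrix `Λ`. -/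
def innerDer (n : ℕ) (Λ : Matrix (Fin n) (Fin n) ℂ) : Der ℂ (MatFun m M n) :=
  ⟨LinearMap.mulLeft ℂ (Λ.map (algebraMap ℂ (Smooth m M))) -
      LinearMap.mulRight ℂ (Λ.map (algebraMap ℂ (Smooth m M))), by
    intro a b
    simp only [LinearMap.sub_apply, LinearMap.mulLeft_apply, LinearMap.mulRight_apply, sub_mul,
      mul_sub, mul_assoc]
    abel⟩

/-- The derivations `e_i` of `A`: the fields of a global frame of the tangent bundle, acting
entrywise, and the inner derivations given by a basis of the traceless matrices. -/
def frame {n : ℕ} [IsManifold (𝓡 m) ∞ M] (V : Fin m → (x : M) → TangentSpace (𝓡 m) x)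
    (hV : IsLocalFrameOn (𝓡 m) (EuclideanSpace ℝ (Fin m)) ∞ V Set.univ)
    (Λ : Module.Basis (Fin (n ^ 2 - 1)) ℂ (LieAlgebra.SpecialLinear.sl (Fin n) ℂ)) :
    Fin m ⊕ Fin (n ^ 2 - 1) → Der ℂ (MatFun m M n)
  | Sum.inl α => entrywise n (fieldDeriv (V α) (contMDiffOn_univ.1 (hV.contMDiffOn α)))
  | Sum.inr s => innerDer n (Λ s : Matrix (Fin n) (Fin n) ℂ)

end MatrixFunctions

end MatrixGeometry

end

/-!
Everything in the statement except the list of derivations is formal, once it is known that the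
frame `e_i` is a basis of `Der A` over the centre `C^∞(M)` of `A`: this is `frameBasis`, and the
formal part is `christoffel_of_basis`, valid for any algebra whose derivations have a finite basis
over the centre.

*The frame is a basis.* A derivation `X` of `A` preserves the centre, so it restricts to a
derivation `D` of `C^∞(M)` (`exists_derivation_algebraMap`). By a bump function argument `D` is
local, and Hadamard's lemma `exists_contDiff_eq_add_apply` writes a function with zero differential
at `x` as a constant plus a sum of products of functions vanishing at `x`; hence `(D f)(x)` depends
on `df_x` only, and `D` is pointwise a combination of the `V_α`. Cramer's rule shows that the
coefficients are smooth (`exists_derivation_eq_sum`). After subtraction of this combination, `X`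
vanishes on `C^∞(M)` and so is inner, `X = [B, ·]` with `B = ∑ X(E_{i0}) E_{0i}`
(`exists_eq_commutator`). Up to a scalar, which does not change the commutator, `B` is a
`C^∞(M)`-combination of the `λ_s` (`exists_eq_smul_one_add_sum`). For independence, restrict a
vanishing combination to the centre, where only the `V_α` act, and use that a traceless central
matrix is zero.

*The formal part.* The dual forms `θ^i` have central values, so they commute with `A`, and a tensor
`t` is `∑ θ^j ⊗ θ^k t(e_j, e_k)` (`IsDual.eq_tensorSum`). Tensors are thus determined by their
values on pairs of basis derivations, which gives the flip and the Christoffel symbols. For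
`ζ = ∑ ζ_i θ^i` the Leibniz rules give
`(∇ᴸ ζ)(e_j, e_k) = e_j(ζ_k) + ∑ ζ_i Γ^i_{jk}` and
`(σ ∇ᴿ ζ)(e_j, e_k) = e_j(ζ_k) + ∑ Γ'^i_{kj} ζ_i`, so compatibility at `ζ` says
`∑ ζ_i Γ^i_{jk} = ∑ Γ'^i_{kj} ζ_i` (`IsDual.leftConn_eq_flip_rightConn_iff`). On the centre the
`ζ_i` are central and this is `Γ' = Γ` with lower indices exchanged; for `ζ = a θ^i` with arbitrary
`a` it also says that the symbols are central, that is, scalar functions.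
-/

noncomputable section

namespace MatrixGeometry

/-! ### Hadamard's lemma -/

section Hadamard

open MeasureTheory Set Metric

variable {E : Type} [NormedAddCommGroup E] [NormedSpace ℝ E] [FiniteDimensional ℝ E]

theorem hasFDerivAt_integral_param {F : Type} [NormedAddCommGroup F] [NormedSpace ℝ F]
    {f : E → ℝ → F} (hf : ContDiff ℝ 1 f.uncurry) (x₀ : E) :
    HasFDerivAt (fun x => ∫ t in (0 : ℝ)..1, f x t)
      (∫ t in (0 : ℝ)..1,
        (fderiv ℝ f.uncurry (x₀, t)).comp (ContinuousLinearMap.inl ℝ E ℝ)) x₀ := by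
  have hc : Continuous fun p : E × ℝ =>
      (fderiv ℝ f.uncurry p).comp (ContinuousLinearMap.inl ℝ E ℝ) :=
    (hf.continuous_fderiv one_ne_zero).clm_comp continuous_const
  obtain ⟨C, hC⟩ := ((isCompact_closedBall x₀ 1).prod
    (isCompact_Icc (a := (0 : ℝ)) (b := 1))).exists_bound_of_continuousOn hc.continuousOn
  refine intervalIntegral.hasFDerivAt_integral_of_dominated_of_fderiv_le
    (F' := fun x t => (fderiv ℝ f.uncurry (x, t)).comp (ContinuousLinearMap.inl ℝ E ℝ))
    (bound := fun _ => C) (ball_mem_nhds x₀ one_pos) ?_ ?_ ?_ ?_ ?_ ?_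
  · exact Filter.Eventually.of_forall fun x =>
      (hf.continuous.comp (Continuous.prodMk_right x)).aestronglyMeasurable
  · exact (hf.continuous.comp (Continuous.prodMk_right x₀)).intervalIntegrable _ _
  · exact (hc.comp (Continuous.prodMk_right x₀)).aestronglyMeasurable
  · refine Filter.Eventually.of_forall fun t ht x hx => hC (x, t) ⟨ball_subset_closedBall hx, ?_⟩
    rw [uIoc_of_le zero_le_one] at ht
    exact Ioc_subset_Icc_self ht
  · exact intervalIntegrable_const
  · refine Filter.Eventually.of_forall fun t _ x _ => ?_
    exact HasFDerivAt.comp (f := fun y => (y, t)) x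
      (hf.differentiable one_ne_zero (x, t)).hasFDerivAt (hasFDerivAt_prodMk_left x t)

theorem contDiff_integral_param_nat (k : ℕ) {F : Type} [NormedAddCommGroup F] [NormedSpace ℝ F]
    {f : E → ℝ → F} (hf : ContDiff ℝ ∞ f.uncurry) :
    ContDiff ℝ k (fun x => ∫ t in (0 : ℝ)..1, f x t) := by
  induction k generalizing F with
  | zero =>
    exact contDiff_zero.2
      (intervalIntegral.continuous_parametric_intervalIntegral_of_continuous' hf.continuous 0 1)
  | succ k ih =>
    refine contDiff_succ_iff_hasFDerivAt.2 ⟨fun x => ∫ t in (0 : ℝ)..1,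
      (fderiv ℝ f.uncurry (x, t)).comp (ContinuousLinearMap.inl ℝ E ℝ), ?_,
      hasFDerivAt_integral_param (hf.of_le (by exact_mod_cast le_top))⟩
    exact ih (f := fun x t => (fderiv ℝ f.uncurry (x, t)).comp (ContinuousLinearMap.inl ℝ E ℝ))
      ((contDiff_infty_iff_fderiv.1 hf).2.clm_comp contDiff_const)

/-- An integral over `[0, 1]` depends smoothly on the parameters of the integrand. -/
theorem contDiff_integral_param {F : Type} [NormedAddCommGroup F] [NormedSpace ℝ F]
    {f : E → ℝ → F} (hf : ContDiff ℝ ∞ f.uncurry) :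
    ContDiff ℝ ∞ (fun x => ∫ t in (0 : ℝ)..1, f x t) :=
  contDiff_infty.2 fun k => contDiff_integral_param_nat k hf

/-- **Hadamard's lemma**: `u(y) - u(x)` is a smooth covector field, with value `du_x` at `x`,
applied to `y - x`. -/
theorem exists_contDiff_eq_add_apply {F : Type} [NormedAddCommGroup F] [NormedSpace ℝ F]
    [CompleteSpace F] {u : E → F} (hu : ContDiff ℝ ∞ u) (x : E) :
    ∃ G : E → E →L[ℝ] F, ContDiff ℝ ∞ G ∧ G x = fderiv ℝ u x ∧
      ∀ y, u y = u x + G y (y - x) := by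
  refine ⟨fun y => ∫ t in (0 : ℝ)..1, fderiv ℝ u (x + t • (y - x)), ?_, ?_, fun y => ?_⟩
  · refine contDiff_integral_param (f := fun y t => fderiv ℝ u (x + t • (y - x))) ?_
    refine (contDiff_infty_iff_fderiv.1 hu).2.comp ?_
    exact contDiff_const.add (contDiff_snd.smul (contDiff_fst.sub contDiff_const))
  · simp
  · have hc : Continuous fun t : ℝ => fderiv ℝ u (x + t • (y - x)) :=
      (contDiff_infty_iff_fderiv.1 hu).2.continuous.comp (by fun_prop)
    rw [ContinuousLinearMap.intervalIntegral_apply (hc.intervalIntegrable _ _),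
      intervalIntegral.integral_eq_sub_of_hasDerivAt (f := fun t : ℝ => u (x + t • (y - x)))]
    · simp
    · intro t _
      have h1 : HasDerivAt (fun t : ℝ => x + t • (y - x)) (y - x) t := by
        simpa using ((hasDerivAt_id t).smul_const (y - x)).const_add x
      exact (hu.differentiable (by simp) _).hasFDerivAt.comp_hasDerivAt t h1
    · exact (hc.clm_apply continuous_const).intervalIntegrable _ _

end Hadamard

/-! ### Smooth functions near a point of a manifold -/

section LocalFunctions

open Filter Topology

variable {m : ℕ} {M : Type*} [TopologicalSpace M] [ChartedSpace (EuclideanSpace ℝ (Fin m)) M]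

/-- The smooth function `χ • (u ∘ φ)` on `M`, where `φ` is the chart at `x`, `χ` is a bump
function supported in its domain, and `u` is a smooth function on the model space. -/
def chartLift [T2Space M] [IsManifold (𝓡 m) ∞ M] {x : M} (χ : SmoothBumpFunction (𝓡 m) x)
    {u : EuclideanSpace ℝ (Fin m) → ℂ} (hu : ContDiff ℝ ∞ u) : Smooth m M :=
  ⟨fun y => χ y • u (extChartAt (𝓡 m) x y),
    χ.contMDiff_smul (hu.contMDiff.comp_contMDiffOn contMDiffOn_extChartAt)⟩

theorem chartLift_eventuallyEq [T2Space M] [IsManifold (𝓡 m) ∞ M] {x : M}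
    (χ : SmoothBumpFunction (𝓡 m) x) {u : EuclideanSpace ℝ (Fin m) → ℂ} (hu : ContDiff ℝ ∞ u) :
    (chartLift χ hu).1 =ᶠ[𝓝 x] u ∘ extChartAt (𝓡 m) x := by
  filter_upwards [χ.eventuallyEq_one] with y hy
  simp [chartLift, hy]

theorem chartLift_apply_self [T2Space M] [IsManifold (𝓡 m) ∞ M] {x : M}
    (χ : SmoothBumpFunction (𝓡 m) x) {u : EuclideanSpace ℝ (Fin m) → ℂ} (hu : ContDiff ℝ ∞ u) :
    (chartLift χ hu).1 x = u (extChartAt (𝓡 m) x x) :=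
  (chartLift_eventuallyEq χ hu).self_of_nhds

/-- Near a point, a smooth function is the pullback by the chart of a function that is smooth on
the whole model space. -/
theorem exists_contDiff_eventuallyEq_comp_extChartAt [IsManifold (𝓡 m) ∞ M] (f : Smooth m M)
    (x : M) : ∃ u : EuclideanSpace ℝ (Fin m) → ℂ, ContDiff ℝ ∞ u ∧
      f.1 =ᶠ[𝓝 x] u ∘ extChartAt (𝓡 m) x := by
  obtain ⟨χ⟩ : Nonempty (SmoothBumpFunction (𝓡 m) x) := inferInstance
  have hsub : tsupport χ.toContDiffBump ⊆ (extChartAt (𝓡 m) x).target := by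
    rw [χ.toContDiffBump.tsupport_eq]
    simpa using χ.closedBall_subset
  have hf : ContDiffOn ℝ ∞ (f.1 ∘ (extChartAt (𝓡 m) x).symm) (extChartAt (𝓡 m) x).target :=
    contMDiffOn_iff_contDiffOn.1 ((f.2 : ContMDiff (𝓡 m) 𝓘(ℝ, ℂ) ∞ f.1).comp_contMDiffOn
      (contMDiffOn_extChartAt_symm x))
  refine ⟨fun y => χ.toContDiffBump y • f.1 ((extChartAt (𝓡 m) x).symm y), ?_, ?_⟩
  · refine contDiff_iff_contDiffAt.2 fun y => ?_
    by_cases hy : y ∈ tsupport χ.toContDiffBump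
    · exact χ.toContDiffBump.contDiff.contDiffAt.smul
        (hf.contDiffAt ((isOpen_extChartAt_target x).mem_nhds (hsub hy)))
    · refine contDiffAt_const (c := (0 : ℂ)) |>.congr_of_eventuallyEq ?_
      filter_upwards [(isClosed_tsupport χ.toContDiffBump).isOpen_compl.mem_nhds hy] with z hz
      rw [image_eq_zero_of_notMem_tsupport hz, zero_smul]
  · filter_upwards [χ.eventuallyEq_one, extChartAt_source_mem_nhds (I := 𝓡 m) x] with y hy hys
    have h1 : χ.toContDiffBump (extChartAt (𝓡 m) x y) = 1 := by
      rw [← Pi.one_apply (M := fun _ : M => ℝ) y, ← hy]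
      exact (χ.eqOn_source (by simpa using hys)).symm
    simp only [Function.comp_apply, h1, one_smul]
    rw [(extChartAt (𝓡 m) x).left_inv hys]

theorem mfderiv_eq_fderiv_of_eventuallyEq {f : M → ℂ} {x : M}
    {u : EuclideanSpace ℝ (Fin m) → ℂ} (hu : DifferentiableAt ℝ u (extChartAt (𝓡 m) x x))
    (h : f =ᶠ[𝓝 x] u ∘ extChartAt (𝓡 m) x) :
    mfderiv (𝓡 m) 𝓘(ℝ, ℂ) f x = fderiv ℝ u (extChartAt (𝓡 m) x x) := by
  refine HasMFDerivAt.mfderiv ⟨?_, ?_⟩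
  · exact (hu.continuousAt.comp (continuousAt_extChartAt x)).congr h.symm
  · refine HasFDerivAt.hasFDerivWithinAt (hu.hasFDerivAt.congr_of_eventuallyEq ?_)
    have h2 := (continuousAt_extChartAt_symm (I := 𝓡 m) x).eventually
      (p := fun y => f y = (u ∘ extChartAt (𝓡 m) x) y) (by rw [extChartAt_to_inv]; exact h)
    filter_upwards [h2, extChartAt_target_mem_nhds (I := 𝓡 m) x] with y hy hyt
    simp only [writtenInExtChartAt, Function.comp_apply, extChartAt_model_space_eq_id,
      PartialEquiv.refl_coe, id]
    rw [hy, Function.comp_apply, (extChartAt (𝓡 m) x).right_inv hyt]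

/-- Every real-linear functional on a tangent space is the differential of a smooth function. -/
theorem exists_mfderiv_eq [T2Space M] [IsManifold (𝓡 m) ∞ M] (x : M)
    (ℓ : EuclideanSpace ℝ (Fin m) →L[ℝ] ℂ) :
    ∃ f : Smooth m M, mfderiv (𝓡 m) 𝓘(ℝ, ℂ) f.1 x = ℓ := by
  obtain ⟨χ⟩ : Nonempty (SmoothBumpFunction (𝓡 m) x) := inferInstance
  refine ⟨chartLift χ ℓ.contDiff, ?_⟩
  rw [mfderiv_eq_fderiv_of_eventuallyEq ℓ.differentiableAt (chartLift_eventuallyEq χ ℓ.contDiff)]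
  exact ℓ.fderiv

end LocalFunctions

/-! ### Derivations of the algebra of smooth functions -/

section FunctionDerivations

open Filter Topology

variable {m : ℕ} {M : Type*} [TopologicalSpace M] [ChartedSpace (EuclideanSpace ℝ (Fin m)) M]

/-- Evaluation at a point, as a homomorphism of algebras. -/
def evalAt (x : M) : Smooth m M →ₐ[ℂ] ℂ :=
  (Pi.evalAlgHom ℂ (fun _ : M => ℂ) x).comp (Smooth m M).val

theorem evalAt_apply (x : M) (f : Smooth m M) : evalAt x f = f.1 x := rfl

theorem evalAt_derivation_mul (D : Derivation ℂ (Smooth m M) (Smooth m M)) (x : M)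
    (f g : Smooth m M) :
    evalAt x (D (f * g)) = f.1 x * evalAt x (D g) + g.1 x * evalAt x (D f) := by
  rw [D.leibniz, smul_eq_mul, smul_eq_mul, map_add, map_mul, map_mul]
  rfl

variable [T2Space M] [IsManifold (𝓡 m) ∞ M]

/-- Derivations of `C^∞(M)` are local. -/
theorem derivation_congr (D : Derivation ℂ (Smooth m M) (Smooth m M)) {x : M}
    {f g : Smooth m M} (h : f.1 =ᶠ[𝓝 x] g.1) : evalAt x (D f) = evalAt x (D g) := by
  obtain ⟨s, hs, hsfg⟩ := eventually_iff_exists_mem.1 h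
  obtain ⟨χ, hχ, -⟩ :=
    (SmoothBumpFunction.nhds_basis_support (I := 𝓡 m) hs).mem_iff.1 (univ_mem : Set.univ ∈ 𝓝 x)
  -- A bump function supported where `f = g` annihilates `f - g`; apply the Leibniz rule.
  set c : Smooth m M := chartLift χ (contDiff_const (c := (1 : ℂ))) with hc
  have hmul : c * (f - g) = 0 := by
    refine Subtype.ext (funext fun y => ?_)
    change (χ y • (1 : ℂ)) * (f.1 y - g.1 y) = 0
    by_cases hy : y ∈ s
    · rw [hsfg y hy, sub_self, mul_zero]
    · rw [image_eq_zero_of_notMem_tsupport fun h' => hy (hχ h'), zero_smul, zero_mul]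
  have h1 := evalAt_derivation_mul D x c (f - g)
  have hcx : c.1 x = 1 := chartLift_apply_self χ contDiff_const
  have hfg : (f - g).1 x = 0 := sub_eq_zero.2 h.self_of_nhds
  rw [hmul, map_zero, map_zero, hcx, hfg, map_sub, map_sub, zero_mul, add_zero, one_mul] at h1
  exact sub_eq_zero.1 h1.symm

/-- A derivation of `C^∞(M)` at a point depends on the differential at that point only. -/
theorem derivation_eq_zero_of_mfderiv_eq_zero (D : Derivation ℂ (Smooth m M) (Smooth m M)) {x : M}
    {f : Smooth m M} (h : mfderiv (𝓡 m) 𝓘(ℝ, ℂ) f.1 x = 0) : evalAt x (D f) = 0 := by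
  obtain ⟨u, hu, hfu⟩ := exists_contDiff_eventuallyEq_comp_extChartAt f x
  obtain ⟨χ⟩ : Nonempty (SmoothBumpFunction (𝓡 m) x) := inferInstance
  set p := extChartAt (𝓡 m) x x with hp
  obtain ⟨G, hG, hGp, hGu⟩ := exists_contDiff_eq_add_apply hu p
  have hG0 : G p = 0 := by
    rw [hGp, ← mfderiv_eq_fderiv_of_eventuallyEq (hu.differentiable (by simp) _) hfu]
    exact h
  have hcoord (i : Fin m) :
      ContDiff ℝ ∞ fun y : EuclideanSpace ℝ (Fin m) => ((y i - p i : ℝ) : ℂ) :=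
    Complex.ofRealCLM.contDiff.comp
      ((contDiff_piLp_apply (p := 2) (i := i)).sub contDiff_const)
  have hGi (i : Fin m) : ContDiff ℝ ∞ fun y => G y (EuclideanSpace.single i 1) :=
    hG.clm_apply contDiff_const
  set F : Smooth m M := algebraMap ℂ (Smooth m M) (u p) +
    ∑ i, chartLift χ (hcoord i) * chartLift χ (hGi i) with hF
  have hfF : f.1 =ᶠ[𝓝 x] F.1 := by
    have h1 : ∀ᶠ y in 𝓝 x, ∀ i, (chartLift χ (hcoord i)).1 y =
        ((extChartAt (𝓡 m) x y i - p i : ℝ) : ℂ) :=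
      eventually_all.2 fun i => chartLift_eventuallyEq χ (hcoord i)
    have h2 : ∀ᶠ y in 𝓝 x, ∀ i, (chartLift χ (hGi i)).1 y =
        G (extChartAt (𝓡 m) x y) (EuclideanSpace.single i 1) :=
      eventually_all.2 fun i => chartLift_eventuallyEq χ (hGi i)
    filter_upwards [hfu, h1, h2] with y hy h1 h2
    have hFy : F.1 y = u p + ∑ i, (chartLift χ (hcoord i)).1 y * (chartLift χ (hGi i)).1 y := by
      rw [← evalAt_apply, hF, map_add, map_sum, AlgHom.commutes]
      simp only [map_mul]
      rfl
    rw [hFy, hy, Function.comp_apply, hGu]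
    congr 1
    have hsum : extChartAt (𝓡 m) x y - p = ∑ i, (extChartAt (𝓡 m) x y i - p i) •
        (EuclideanSpace.single i 1 : EuclideanSpace ℝ (Fin m)) := by
      ext j
      simp [Finset.sum_apply, Pi.single_apply]
    rw [hsum, map_sum]
    refine Finset.sum_congr rfl fun i _ => ?_
    rw [h1, h2, map_smul, Complex.real_smul]
  rw [derivation_congr D hfF, hF, map_add, D.map_algebraMap, zero_add, map_sum, map_sum]
  refine Finset.sum_eq_zero fun i _ => ?_
  rw [evalAt_derivation_mul, chartLift_apply_self, chartLift_apply_self, ← hp, hG0]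
  simp

theorem evalAt_fieldDeriv (V : (x : M) → TangentSpace (𝓡 m) x)
    (hV : ContMDiff (𝓡 m) (𝓡 m).tangent ∞ (fun x => (⟨x, V x⟩ : TangentBundle (𝓡 m) M)))
    (f : Smooth m M) (x : M) :
    evalAt x (fieldDeriv V hV f) = mfderiv (𝓡 m) 𝓘(ℝ, ℂ) f.1 x (V x) := rfl

variable {V : Fin m → (x : M) → TangentSpace (𝓡 m) x}
  (hV : IsLocalFrameOn (𝓡 m) (EuclideanSpace ℝ (Fin m)) ∞ V Set.univ)

/-- The derivations of `C^∞(M)` given by the fields of a global frame. -/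
def frameDeriv (α : Fin m) : Derivation ℂ (Smooth m M) (Smooth m M) :=
  fieldDeriv (V α) (contMDiffOn_univ.1 (hV.contMDiffOn α))

/-- At every point there are smooth functions whose differentials are dual to the frame. -/
theorem exists_dual_functions (x : M) :
    ∃ h : Fin m → Smooth m M, ∀ α β, evalAt x (frameDeriv hV α (h β)) = if α = β then 1 else 0 := by
  set b : Module.Basis (Fin m) ℝ (EuclideanSpace ℝ (Fin m)) :=
    Module.Basis.mk (hV.linearIndependent (Set.mem_univ x)) (hV.generating (Set.mem_univ x)) with hb
  have key (β : Fin m) := exists_mfderiv_eq x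
    (Complex.ofRealCLM.comp (LinearMap.toContinuousLinearMap (b.coord β)))
  choose h hh using key
  refine ⟨h, fun α β => ?_⟩
  rw [frameDeriv, evalAt_fieldDeriv, hh]
  have hα : b α = V α x := Module.Basis.mk_apply _ _ α
  change ((b.coord β (V α x) : ℝ) : ℂ) = _
  rw [← hα, b.coord_apply, b.repr_self, Finsupp.single_apply]
  split_ifs <;> simp

theorem mfderiv_eq_zero_of_frameDeriv {x : M} {f : Smooth m M}
    (h : ∀ α, evalAt x (frameDeriv hV α f) = 0) : mfderiv (𝓡 m) 𝓘(ℝ, ℂ) f.1 x = 0 := by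
  refine ContinuousLinearMap.coe_injective
    (LinearMap.ext_on_range (v := fun α => V α x)
      (top_le_iff.1 (hV.generating (Set.mem_univ x))) fun α => ?_)
  exact h α

/-- Expansion of a derivation at `y` through any functions whose differentials are dual to the
frame at `y`. -/
theorem derivation_eq_sum_of_dual (D : Derivation ℂ (Smooth m M) (Smooth m M)) {y : M}
    {h : Fin m → Smooth m M}
    (hh : ∀ α β, evalAt y (frameDeriv hV α (h β)) = if α = β then 1 else 0) (f : Smooth m M) :
    evalAt y (D f) = ∑ α, evalAt y (D (h α)) * evalAt y (frameDeriv hV α f) := by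
  have h0 := derivation_eq_zero_of_mfderiv_eq_zero D (mfderiv_eq_zero_of_frameDeriv hV (x := y)
    (f := f - ∑ α, evalAt y (frameDeriv hV α f) • h α) fun β => by
      simp only [map_sub, map_sum, Derivation.map_smul, map_smul, hh]
      simp)
  simp only [map_sub, map_sum, Derivation.map_smul, map_smul, smul_eq_mul] at h0
  rw [sub_eq_zero.1 h0]
  exact Finset.sum_congr rfl fun α _ => mul_comm _ _

/-- A function `c` is smooth if for every point there are smooth `p`, `q` with `p c = q` and
`p ≠ 0` at the point. -/
theorem mem_smooth_of_mul_eq {c : M → ℂ}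
    (hc : ∀ x, ∃ p q : Smooth m M, p.1 x ≠ 0 ∧ ∀ y, p.1 y * c y = q.1 y) : c ∈ Smooth m M := by
  refine fun x => ?_
  obtain ⟨p, q, hpx, hpq⟩ := hc x
  have hp : ContMDiff (𝓡 m) 𝓘(ℝ, ℂ) ∞ p.1 := p.2
  have hq : ContMDiff (𝓡 m) 𝓘(ℝ, ℂ) ∞ q.1 := q.2
  have h1 : ContMDiffAt (𝓡 m) 𝓘(ℝ, ℂ) ∞ (fun y => (p.1 y)⁻¹ * q.1 y) x := by
    have hdiv : ContMDiffAt 𝓘(ℝ, ℂ × ℂ) 𝓘(ℝ, ℂ) ∞ (fun z : ℂ × ℂ => z.1⁻¹ * z.2)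
        (p.1 x, q.1 x) :=
      ((contDiffAt_fst.inv hpx).mul contDiffAt_snd).contMDiffAt
    exact hdiv.comp x (hp.prodMk_space hq).contMDiffAt
  refine h1.congr_of_eventuallyEq ?_
  filter_upwards [hp.continuous.continuousAt.eventually_ne hpx] with y hy
  rw [← hpq, inv_mul_cancel_left₀ hy]

/-- The derivations of `C^∞(M)` are the combinations of the fields of a global frame. -/
theorem exists_derivation_eq_sum (D : Derivation ℂ (Smooth m M) (Smooth m M)) :
    ∃ c : Fin m → Smooth m M, ∀ f, D f = ∑ α, c α * frameDeriv hV α f := by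
  choose h hh using fun y : M => exists_dual_functions hV y
  set c : Fin m → M → ℂ := fun α y => evalAt y (D (h y α)) with hc
  have hD (f : Smooth m M) (y : M) :
      evalAt y (D f) = ∑ α, c α y * evalAt y (frameDeriv hV α f) :=
    derivation_eq_sum_of_dual hV D (hh y) f
  have hsm (α : Fin m) : c α ∈ Smooth m M := by
    refine mem_smooth_of_mul_eq fun x => ?_
    -- Solve for the coefficients by Cramer's rule, testing on functions dual to the frame at `x`.
    set W : Matrix (Fin m) (Fin m) (Smooth m M) := .of fun α β => frameDeriv hV α (h x β) with hW
    refine ⟨W.det, ∑ β, D (h x β) * W.adjugate β α, ?_, fun y => ?_⟩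
    · rw [← evalAt_apply]
      have h1 : W.map (evalAt x) = 1 := by
        ext α β
        simp [hW, hh, Matrix.one_apply]
      have h2 : evalAt x W.det = 1 := by
        rw [AlgHom.map_det, AlgHom.mapMatrix_apply, h1, Matrix.det_one]
      exact h2.trans_ne one_ne_zero
    · change evalAt y W.det * c α y = evalAt y (∑ β, D (h x β) * W.adjugate β α)
      have h3 (γ : Fin m) :
          ∑ β, evalAt y (W γ β) * evalAt y (W.adjugate β α) =
            if γ = α then evalAt y W.det else 0 := by
        have h4 := congrArg (evalAt y) (congrFun (congrFun W.mul_adjugate γ) α)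
        rw [Matrix.mul_apply, map_sum] at h4
        simp only [map_mul, Matrix.smul_apply, Matrix.one_apply, smul_eq_mul] at h4
        rw [h4]
        split_ifs <;> simp
      simp only [map_sum, map_mul, hD, Finset.sum_mul]
      rw [Finset.sum_comm]
      have h5 (γ : Fin m) : ∑ β, c γ y * evalAt y (frameDeriv hV γ (h x β)) *
          evalAt y (W.adjugate β α) = c γ y * if γ = α then evalAt y W.det else 0 := by
        rw [← h3, Finset.mul_sum]
        exact Finset.sum_congr rfl fun β _ => mul_assoc _ _ _
      simp only [h5]
      simp [mul_comm]
  refine ⟨fun α => ⟨c α, hsm α⟩, fun f => Subtype.ext (funext fun y => ?_)⟩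
  change evalAt y (D f) = evalAt y (∑ α, (⟨c α, hsm α⟩ : Smooth m M) * frameDeriv hV α f)
  rw [hD, map_sum]
  simp only [map_mul]
  rfl

theorem eq_zero_of_sum_mul_frameDeriv {c : Fin m → Smooth m M}
    (h : ∀ f, ∑ α, c α * frameDeriv hV α f = 0) (α : Fin m) : c α = 0 := by
  refine Subtype.ext (funext fun x => ?_)
  change evalAt x (c α) = 0
  obtain ⟨g, hg⟩ := exists_dual_functions hV x
  have h1 := congrArg (evalAt x) (h (g α))
  simp only [map_sum, map_mul, hg, map_zero] at h1
  simpa using h1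

end FunctionDerivations

/-! ### Derivations as a module over the centre -/

section CentralModule

variable {k A : Type*} [CommRing k] [Ring A] [Algebra k A]

theorem Der.map_mul (X : Der k A) (a b : A) :
    X.1 (a * b) = X.1 a * b + a * X.1 b := X.2 a b

theorem Der.sum_smul_apply {ι : Type*}
    (s : Finset ι) (c : ι → Subalgebra.center k A) (X : ι → Der k A) (a : A) :
    (∑ i ∈ s, c i • X i).1 a = ∑ i ∈ s, (c i : A) * (X i).1 a := by
  rw [AddSubmonoidClass.coe_finsetSum, LinearMap.sum_apply]
  rfl

/-- The pointwise difference of a derivation and a central combination of derivations is again a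
derivation. -/
theorem Der.exists_sub_sum {ι : Type*} [Fintype ι] (Y : Der k A)
    (c : ι → Subalgebra.center k A) (X : ι → Der k A) :
    ∃ Z : Der k A, ∀ a, Z.1 a = Y.1 a - ∑ i, (c i : A) * (X i).1 a :=
  ⟨Y - ∑ i, c i • X i, fun a => by rw [← Der.sum_smul_apply]; rfl⟩

theorem Der.linearIndependent {ι : Type*} [Fintype ι] {X : ι → Der k A}
    (h : ∀ c : ι → Subalgebra.center k A, (∀ a, ∑ i, (c i : A) * (X i).1 a = 0) → ∀ i, c i = 0) :
    LinearIndependent (Subalgebra.center k A) X := by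
  refine (Fintype.linearIndependent_iff (R := Subalgebra.center k A) (v := X)).2
    fun c hc => h c fun a => ?_
  rw [← Der.sum_smul_apply, hc]
  rfl

theorem Der.top_le_span {ι : Type*} [Fintype ι] {X : ι → Der k A}
    (h : ∀ Y : Der k A, ∃ c : ι → Subalgebra.center k A,
      ∀ a, Y.1 a = ∑ i, (c i : A) * (X i).1 a) :
    ⊤ ≤ Submodule.span (Subalgebra.center k A) (Set.range X) := by
  intro Y _
  obtain ⟨c, hc⟩ := h Y
  refine (Submodule.mem_span_range_iff_exists_fun _).2 ⟨c, Subtype.ext (LinearMap.ext fun a => ?_)⟩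
  rw [hc]
  exact Der.sum_smul_apply _ c X a

/-- Derivations preserve the centre. -/
theorem Der.commute_apply (X : Der k A) {z : A}
    (hz : ∀ a, a * z = z * a) (a : A) : a * X.1 z = X.1 z * a := by
  have h := congrArg X.1 (hz a)
  rw [Der.map_mul, Der.map_mul, hz, add_comm] at h
  exact add_right_cancel h

end CentralModule

/-! ### Derivations of matrix algebras -/

section MatrixDerivations

variable {n : ℕ} {R : Type*} [CommRing R] [Algebra ℂ R]

theorem algebraMap_mem_center (r : R) : algebraMap R (Matrix (Fin n) (Fin n) R) r ∈
    Subalgebra.center ℂ (Matrix (Fin n) (Fin n) R) :=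
  Subalgebra.mem_center_iff.2 fun a => (Algebra.commutes r a).symm

theorem exists_eq_algebraMap_of_commute {z : Matrix (Fin n) (Fin n) R} (hz : ∀ a, a * z = z * a) :
    ∃ r : R, z = algebraMap R (Matrix (Fin n) (Fin n) R) r := by
  have h : z ∈ Set.center (Matrix (Fin n) (Fin n) R) := Semigroup.mem_center_iff.2 hz
  rw [Matrix.center_eq_range] at h
  obtain ⟨r, hr⟩ := h
  exact ⟨r, hr.symm⟩

/-- A derivation of a matrix algebra over `R` restricts to a derivation of `R`. -/
theorem exists_derivation_algebraMap [NeZero n] (X : Der ℂ (Matrix (Fin n) (Fin n) R)) :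
    ∃ D : Derivation ℂ R R, ∀ r, X.1 (algebraMap R _ r) = algebraMap R _ (D r) := by
  have h (r : R) : X.1 (algebraMap R _ r) = algebraMap R _ (X.1 (algebraMap R _ r) 0 0) := by
    obtain ⟨s, hs⟩ := exists_eq_algebraMap_of_commute
      (Der.commute_apply X fun a => (Algebra.commutes r a).symm)
    rw [hs]
    simp [Matrix.algebraMap_matrix_apply]
  refine ⟨Derivation.mk' ((Matrix.entryLinearMap ℂ R (0 : Fin n) (0 : Fin n)).comp
    (X.1.comp (Algebra.linearMap R (Matrix (Fin n) (Fin n) R) |>.restrictScalars ℂ))) ?_, h⟩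
  intro r s
  change X.1 (algebraMap R _ (r * s)) 0 0 =
    r • X.1 (algebraMap R _ s) 0 0 + s • X.1 (algebraMap R _ r) 0 0
  rw [RingHom.map_mul, Der.map_mul, Matrix.add_apply, ← Algebra.commutes, ← Algebra.smul_def,
    ← Algebra.smul_def, Matrix.smul_apply, Matrix.smul_apply, add_comm]

/-- A derivation of a matrix algebra over `R` that vanishes on `R` is inner. -/
theorem exists_eq_commutator [NeZero n] (X : Der ℂ (Matrix (Fin n) (Fin n) R))
    (hX : ∀ r : R, X.1 (algebraMap R _ r) = 0) :
    ∃ B : Matrix (Fin n) (Fin n) R, ∀ a, X.1 a = B * a - a * B := by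
  have hsmul (r : R) (a : Matrix (Fin n) (Fin n) R) : X.1 (r • a) = r • X.1 a := by
    rw [Algebra.smul_def, Der.map_mul, hX, zero_mul, zero_add, ← Algebra.smul_def]
  let E (i j : Fin n) : Matrix (Fin n) (Fin n) R := Matrix.single i j 1
  have hE (i : Fin n) : E i 0 * E 0 i = Matrix.single i i 1 := by simp [E]
  have hone : ∑ i, E i 0 * E 0 i = 1 := by
    simp only [hE]
    ext i j
    simp [Matrix.sum_apply, Matrix.single_apply, Matrix.one_apply, ite_and]
  refine ⟨∑ i, X.1 (E i 0) * E 0 i, fun a => ?_⟩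
  have hl (i : Fin n) : E 0 i * a = ∑ j, a i j • E 0 j := by
    ext p q
    simp [E, Matrix.mul_apply, Matrix.sum_apply, Matrix.single_apply, ite_and]
  have hr (i : Fin n) : a * E i 0 = ∑ j, a j i • E j 0 := by
    ext p q
    simp [E, Matrix.mul_apply, Matrix.sum_apply, Matrix.single_apply, ite_and]
  have h1 : ∑ i, X.1 (a * E i 0) * E 0 i = (∑ i, X.1 (E i 0) * E 0 i) * a := by
    simp only [Finset.sum_mul, mul_assoc, hl, hr, map_sum, hsmul, Finset.mul_sum, smul_mul_assoc,
      mul_smul_comm]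
    exact Finset.sum_comm
  have h2 : ∑ i, X.1 (a * E i 0) * E 0 i = X.1 a + a * ∑ i, X.1 (E i 0) * E 0 i := by
    simp only [Der.map_mul, add_mul, Finset.sum_add_distrib, Finset.mul_sum, mul_assoc]
    rw [← Finset.mul_sum, hone, mul_one]
  rw [← h1, h2, add_sub_cancel_right]

/-- The commutator `B ↦ [B, a]`, as an `R`-linear map. -/
def commutatorWith (a : Matrix (Fin n) (Fin n) R) :
    Matrix (Fin n) (Fin n) R →ₗ[R] Matrix (Fin n) (Fin n) R :=
  LinearMap.mulRight R a - LinearMap.mulLeft R a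

theorem commutatorWith_apply (a B : Matrix (Fin n) (Fin n) R) :
    commutatorWith a B = B * a - a * B := rfl

theorem commutatorWith_one (a : Matrix (Fin n) (Fin n) R) : commutatorWith a 1 = 0 := by
  simp [commutatorWith_apply]

variable (Λ : Module.Basis (Fin (n ^ 2 - 1)) ℂ (LieAlgebra.SpecialLinear.sl (Fin n) ℂ))

/-- The constant matrix `λ_s` with entries in `R`. -/
def constMat (R : Type*) [CommRing R] [Algebra ℂ R] (s : Fin (n ^ 2 - 1)) :
    Matrix (Fin n) (Fin n) R :=
  (Λ s : Matrix (Fin n) (Fin n) ℂ).map (algebraMap ℂ R)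

/-- Up to scalar matrices, every matrix over `R` is an `R`-combination of traceless constant
ones. -/
theorem exists_eq_smul_one_add_sum [NeZero n] (B : Matrix (Fin n) (Fin n) R) :
    ∃ (r : R) (g : Fin (n ^ 2 - 1) → R), B = r • 1 + ∑ s, g s • constMat Λ R s := by
  -- The traceless parts of the matrix units have constant coordinates in the basis `Λ`.
  have hP (k l : Fin n) : ∃ (q : ℂ) (c : Fin (n ^ 2 - 1) → ℂ), Matrix.single k l (1 : ℂ) =
      q • 1 + ∑ s, c s • (Λ s : Matrix (Fin n) (Fin n) ℂ) := by
    set q : ℂ := (Matrix.single k l (1 : ℂ)).trace / n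
    have hn0 : (n : ℂ) ≠ 0 := Nat.cast_ne_zero.2 (NeZero.ne n)
    have hmem : Matrix.single k l (1 : ℂ) - q • 1 ∈ LieAlgebra.SpecialLinear.sl (Fin n) ℂ := by
      change Matrix.trace (Matrix.single k l (1 : ℂ) - q • 1) = 0
      rw [Matrix.trace_sub, Matrix.trace_smul, Matrix.trace_one, Fintype.card_fin, smul_eq_mul,
        div_mul_cancel₀ _ hn0, sub_self]
    refine ⟨q, Λ.repr ⟨_, hmem⟩, ?_⟩
    have h := congrArg Subtype.val (Λ.sum_repr ⟨_, hmem⟩)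
    rw [← sub_eq_iff_eq_add']
    refine h.symm.trans ?_
    rw [AddSubmonoidClass.coe_finsetSum]
    rfl
  choose q c hc using hP
  have hR (k l : Fin n) : Matrix.single k l (1 : R) =
      algebraMap ℂ R (q k l) • 1 + ∑ s, algebraMap ℂ R (c k l s) • constMat Λ R s := by
    have h := congrArg (RingHom.mapMatrix (m := Fin n) (algebraMap ℂ R)) (hc k l)
    rw [map_add, map_sum] at h
    have hs (t : ℂ) (N : Matrix (Fin n) (Fin n) ℂ) : (algebraMap ℂ R).mapMatrix (t • N) =
        algebraMap ℂ R t • N.map (algebraMap ℂ R) := by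
      ext i j
      simp
    simp only [hs] at h
    simpa [constMat] using h
  refine ⟨∑ k, ∑ l, B k l * algebraMap ℂ R (q k l),
    fun s => ∑ k, ∑ l, B k l * algebraMap ℂ R (c k l s), ?_⟩
  have hB : B = ∑ k, ∑ l, B k l • Matrix.single k l (1 : R) := by
    conv_lhs => rw [Matrix.matrix_eq_sum_single B]
    simp [Matrix.smul_single]
  conv_lhs => rw [hB]
  simp only [hR, smul_add, Finset.smul_sum, Finset.sum_add_distrib, Finset.sum_smul, smul_smul]
  congr 1
  exact (Finset.sum_congr rfl fun k _ => Finset.sum_comm).trans Finset.sum_comm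

theorem trace_constMat (s : Fin (n ^ 2 - 1)) : (constMat Λ R s).trace = 0 := by
  have h : Matrix.trace (Λ s : Matrix (Fin n) (Fin n) ℂ) = 0 := (Λ s).2
  have h2 := congrArg (algebraMap ℂ R) h
  rw [map_zero] at h2
  rw [← h2, Matrix.trace, Matrix.trace, map_sum]
  rfl

/-- A central combination of traceless constant matrices is zero. -/
theorem sum_constMat_eq_zero_of_commute [NeZero n] {g : Fin (n ^ 2 - 1) → R}
    (h : ∀ a, a * ∑ s, g s • constMat Λ R s = (∑ s, g s • constMat Λ R s) * a) :
    ∑ s, g s • constMat Λ R s = 0 := by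
  obtain ⟨r, hr⟩ := exists_eq_algebraMap_of_commute h
  have h1 : (∑ s, g s • constMat Λ R s).trace = 0 := by
    simp [Matrix.trace_sum, Matrix.trace_smul, trace_constMat]
  rw [hr, Algebra.algebraMap_eq_smul_one, Matrix.trace_smul, Matrix.trace_one, Fintype.card_fin,
    smul_eq_mul] at h1
  have hn0 : (n : ℂ) ≠ 0 := Nat.cast_ne_zero.2 (NeZero.ne n)
  have h2 : r = 0 := by
    have h3 : r * algebraMap ℂ R (n : ℂ) * algebraMap ℂ R (n : ℂ)⁻¹ = 0 := by
      rw [map_natCast, h1, zero_mul]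
    rwa [mul_assoc, ← RingHom.map_mul, mul_inv_cancel₀ hn0, RingHom.map_one, mul_one] at h3
  rw [hr, h2, map_zero]

end MatrixDerivations

/-! ### The frame is a basis of the module of derivations -/

section FrameBasis

variable {m n : ℕ} {M : Type*} [TopologicalSpace M]
  [ChartedSpace (EuclideanSpace ℝ (Fin m)) M]

theorem entrywise_algebraMap (D : Derivation ℂ (Smooth m M) (Smooth m M)) (f : Smooth m M) :
    (entrywise n D).1 (algebraMap _ _ f) = algebraMap _ _ (D f) := by
  ext i j : 1
  change D (algebraMap (Smooth m M) (MatFun m M n) f i j) = _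
  rw [Matrix.algebraMap_matrix_apply, Matrix.algebraMap_matrix_apply]
  split_ifs <;> simp

/-- A smooth function as an element of the centre of `A`. -/
def smoothToCenter (n : ℕ) (f : Smooth m M) : Subalgebra.center ℂ (MatFun m M n) :=
  ⟨algebraMap _ _ f, algebraMap_mem_center f⟩

theorem exists_eq_smoothToCenter (z : Subalgebra.center ℂ (MatFun m M n)) :
    ∃ f : Smooth m M, z = smoothToCenter n f := by
  obtain ⟨f, hf⟩ := exists_eq_algebraMap_of_commute (Subalgebra.mem_center_iff.1 z.2)
  exact ⟨f, Subtype.ext hf⟩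

theorem smoothToCenter_mul (f : Smooth m M) (a : MatFun m M n) :
    (smoothToCenter n f : MatFun m M n) * a = f • a := (Algebra.smul_def f a).symm

variable [T2Space M] [IsManifold (𝓡 m) ∞ M] {V : Fin m → (x : M) → TangentSpace (𝓡 m) x}
  (hV : IsLocalFrameOn (𝓡 m) (EuclideanSpace ℝ (Fin m)) ∞ V Set.univ)
  (Λ : Module.Basis (Fin (n ^ 2 - 1)) ℂ (LieAlgebra.SpecialLinear.sl (Fin n) ℂ))

theorem sum_smoothToCenter_mul_frame (r : Fin m ⊕ Fin (n ^ 2 - 1) → Smooth m M)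
    (a : MatFun m M n) :
    ∑ i, (smoothToCenter n (r i) : MatFun m M n) * (frame V hV Λ i).1 a =
      (∑ α, r (Sum.inl α) • (entrywise n (frameDeriv hV α)).1 a) +
        commutatorWith a (∑ s, r (Sum.inr s) • constMat Λ _ s) := by
  rw [Fintype.sum_sum_type, map_sum]
  simp only [smoothToCenter_mul, map_smul]
  rfl

theorem frame_linearIndependent [NeZero n] :
    LinearIndependent (Subalgebra.center ℂ (MatFun m M n)) (frame V hV Λ) := by
  refine Der.linearIndependent fun c hc => ?_
  choose r hr using fun i => exists_eq_smoothToCenter (c i)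
  have h (a : MatFun m M n) : (∑ α, r (Sum.inl α) • (entrywise n (frameDeriv hV α)).1 a) +
        commutatorWith a (∑ s, r (Sum.inr s) • constMat Λ _ s) = 0 := by
    rw [← sum_smoothToCenter_mul_frame, ← hc a]
    simp only [hr]
  have hinj : Function.Injective (algebraMap (Smooth m M) (MatFun m M n)) := by
    intro f g hfg
    simpa [Matrix.algebraMap_matrix_apply] using congrFun (congrFun hfg 0) 0
  have hl : ∀ α, r (Sum.inl α) = 0 := by
    refine eq_zero_of_sum_mul_frameDeriv hV fun f => hinj ?_
    have h1 := h (algebraMap _ _ f)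
    rw [commutatorWith_apply, Algebra.commutes, sub_self, add_zero] at h1
    simp only [entrywise_algebraMap, Algebra.smul_def] at h1
    rw [map_zero, ← h1, map_sum]
    simp only [RingHom.map_mul]
  have h0 : ∑ s, r (Sum.inr s) • constMat Λ (Smooth m M) s = 0 := by
    refine sum_constMat_eq_zero_of_commute Λ fun a => ?_
    have h1 := h a
    simp only [hl, zero_smul, Finset.sum_const_zero, zero_add, commutatorWith_apply] at h1
    exact (sub_eq_zero.1 h1).symm
  have hr0 : ∀ s, r (Sum.inr s) = 0 := by
    intro s
    refine Subtype.ext (funext fun x => ?_)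
    have hx : ∑ s, (evalAt x (r (Sum.inr s))) • Λ s = 0 := by
      refine Subtype.ext ?_
      rw [AddSubmonoidClass.coe_finsetSum]
      ext i j
      have h1 := congrArg (evalAt x) (congrFun (congrFun h0 i) j)
      simp only [Matrix.sum_apply, Matrix.smul_apply, map_sum, smul_eq_mul, map_mul, constMat,
        Matrix.map_apply, AlgHom.commutes, Matrix.zero_apply, map_zero] at h1
      simp only [Matrix.sum_apply]
      exact h1
    exact Fintype.linearIndependent_iff.1 Λ.linearIndependent _ hx s
  have hzero : smoothToCenter n (0 : Smooth m M) = 0 := Subtype.ext (map_zero _)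
  rintro (α | s)
  · rw [hr, hl, hzero]
  · rw [hr, hr0, hzero]

theorem top_le_span_frame [NeZero n] :
    ⊤ ≤ Submodule.span (Subalgebra.center ℂ (MatFun m M n)) (Set.range (frame V hV Λ)) := by
  refine Der.top_le_span fun X => ?_
  obtain ⟨D, hD⟩ := exists_derivation_algebraMap X
  obtain ⟨c, hc⟩ := exists_derivation_eq_sum hV D
  -- Once the vector field part is subtracted, what is left vanishes on `C^∞(M)`, hence is inner.
  obtain ⟨Z, hZ⟩ := Der.exists_sub_sum X (fun α => smoothToCenter n (c α))
    (fun α => entrywise n (frameDeriv hV α))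
  simp only [smoothToCenter_mul] at hZ
  obtain ⟨B, hB⟩ := exists_eq_commutator Z (fun f => by
    rw [hZ, hD, hc, map_sum, sub_eq_zero]
    simp only [entrywise_algebraMap, Algebra.smul_def, RingHom.map_mul])
  obtain ⟨r, g, hg⟩ := exists_eq_smul_one_add_sum Λ B
  refine ⟨fun i => smoothToCenter n (Sum.elim c g i), fun a => ?_⟩
  have h1 := hB a
  rw [hZ, ← commutatorWith_apply, hg, map_add, map_smul, commutatorWith_one, smul_zero,
    zero_add, sub_eq_iff_eq_add'] at h1
  rw [h1, sum_smoothToCenter_mul_frame]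
  rfl

/-- The basis of `Der A` over the centre of `A` that consists of the frame derivations. -/
def frameBasis [NeZero n] :
    Module.Basis (Fin m ⊕ Fin (n ^ 2 - 1)) (Subalgebra.center ℂ (MatFun m M n))
      (Der ℂ (MatFun m M n)) :=
  Module.Basis.mk (frame_linearIndependent hV Λ) (top_le_span_frame hV Λ)

theorem frameBasis_apply [NeZero n] (i : Fin m ⊕ Fin (n ^ 2 - 1)) :
    frameBasis hV Λ i = frame V hV Λ i := Module.Basis.mk_apply _ _ i

end FrameBasis

/-! ### One-forms and two-tensors when the derivations form a free module -/

section FreeDerivations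

variable {k A : Type*} [CommRing k] [Ring A] [Algebra k A]

theorem BalTensor.induction {E F : Type*} [AddCommGroup E] [AddCommGroup F] [Module k E]
    [Module k F] [Module A E] [Module Aᵐᵒᵖ E] [SMulCommClass A Aᵐᵒᵖ E] [SMulCommClass A k E]
    [SMulCommClass Aᵐᵒᵖ k E] [Module A F] [Module Aᵐᵒᵖ F] [SMulCommClass A Aᵐᵒᵖ F]
    [SMulCommClass A k F] [SMulCommClass Aᵐᵒᵖ k F] {P : BalTensor k A E F → Prop}
    (h0 : P 0) (htmul : ∀ ζ ρ, P (btmul k A ζ ρ)) (hadd : ∀ s t, P s → P t → P (s + t))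
    (t : BalTensor k A E F) : P t := by
  obtain ⟨t, rfl⟩ := (balancingRelations k A E F).mkQ_surjective t
  induction t using TensorProduct.induction_on with
  | zero => rw [map_zero]; exact h0
  | tmul ζ ρ => exact htmul ζ ρ
  | add s t hs ht => rw [map_add]; exact hadd _ _ hs ht

theorem evalTwo_add (s t : BalTensor k A (OneForms k A) (OneForms k A)) (X Y : Der k A) :
    evalTwo k A (s + t) X Y = evalTwo k A s X Y + evalTwo k A t X Y := by
  rw [map_add]; rfl

theorem evalTwo_zero (X Y : Der k A) : evalTwo k A 0 X Y = 0 := by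
  rw [map_zero]; rfl

theorem evalTwo_sum {ι : Type*} (s : Finset ι)
    (t : ι → BalTensor k A (OneForms k A) (OneForms k A)) (X Y : Der k A) :
    evalTwo k A (∑ i ∈ s, t i) X Y = ∑ i ∈ s, evalTwo k A (t i) X Y := by
  rw [map_sum, Finset.sum_apply, Finset.sum_apply]

theorem evalTwo_scalar_smul (c : k) (t : BalTensor k A (OneForms k A) (OneForms k A))
    (X Y : Der k A) : evalTwo k A (c • t) X Y = c • evalTwo k A t X Y := by
  rw [map_smul]; rfl

theorem evalTwo_smul (a : A) (t : BalTensor k A (OneForms k A) (OneForms k A)) (X Y : Der k A) :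
    evalTwo k A (a • t) X Y = a * evalTwo k A t X Y := by
  induction t using BalTensor.induction with
  | h0 => rw [smul_zero, evalTwo_zero, mul_zero]
  | htmul α β => exact mul_assoc a (α X) (β Y)
  | hadd s t hs ht => rw [smul_add, evalTwo_add, evalTwo_add, hs, ht, mul_add]

theorem evalTwo_op_smul (a : A) (t : BalTensor k A (OneForms k A) (OneForms k A))
    (X Y : Der k A) : evalTwo k A (op a • t) X Y = evalTwo k A t X Y * a := by
  induction t using BalTensor.induction with
  | h0 => rw [smul_zero, evalTwo_zero, zero_mul]
  | htmul α β => exact (mul_assoc (α X) (β Y) a).symm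
  | hadd s t hs ht => rw [smul_add, evalTwo_add, evalTwo_add, hs, ht, add_mul]

variable {ι : Type*} [Fintype ι] [DecidableEq ι]
  (b : Module.Basis ι (Subalgebra.center k A) (Der k A))

/-- The coordinate one-forms of a basis of `Der A` over the centre. -/
def coordForm (i : ι) : OneForms k A where
  toFun X := (b.repr X i : A)
  map_add' X Y := by rw [map_add]; rfl
  map_smul' z X := by rw [map_smul]; rfl

theorem isDual_coordForm : IsDual (coordForm b) b := by
  intro i j
  change ((b.repr (b j) i : Subalgebra.center k A) : A) = _
  rw [b.repr_self, Finsupp.single_apply]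
  simp only [eq_comm (a := j)]
  split_ifs <;> rfl

theorem existsUnique_isDual : ∃! θ : ι → OneForms k A, IsDual θ b :=
  ⟨coordForm b, isDual_coordForm b, fun θ hθ => funext fun i => b.ext fun j => by
    rw [hθ i j, isDual_coordForm b i j]⟩

variable {b} {θ : ι → OneForms k A} (hθ : IsDual θ b)
include hθ

theorem IsDual.eq_coordForm : θ = coordForm b :=
  (existsUnique_isDual b).unique hθ (isDual_coordForm b)

theorem IsDual.commute_apply (i : ι) (X : Der k A) (a : A) : a * θ i X = θ i X * a := by
  rw [hθ.eq_coordForm]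
  exact Subalgebra.mem_center_iff.1 (b.repr X i).2 a

theorem IsDual.smul_eq_op_smul (a : A) (i : ι) : a • θ i = op a • θ i :=
  LinearMap.ext fun X => hθ.commute_apply i X a

theorem IsDual.apply_eq_sum (α : OneForms k A) (X : Der k A) :
    α X = ∑ i, θ i X * α (b i) := by
  conv_lhs => rw [← b.sum_repr X]
  rw [map_sum, hθ.eq_coordForm]
  exact Finset.sum_congr rfl fun i _ => map_smul α _ _

theorem IsDual.eq_sum_smul (α : OneForms k A) : α = ∑ i, α (b i) • θ i := by
  refine LinearMap.ext fun X => ?_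
  rw [hθ.apply_eq_sum, LinearMap.sum_apply]
  exact Finset.sum_congr rfl fun i _ => (hθ.commute_apply i X _).symm

theorem IsDual.eq_sum_op_smul (α : OneForms k A) : α = ∑ i, op (α (b i)) • θ i := by
  simp only [← hθ.smul_eq_op_smul]
  exact hθ.eq_sum_smul α

theorem IsDual.evalTwo_tensorSum_basis (G : ι → ι → A) (p q : ι) :
    evalTwo k A (tensorSum θ G) (b p) (b q) = G p q := by
  have h (i j : ι) : evalTwo k A (btmul k A (θ i) (op (G i j) • θ j)) (b p) (b q) =
      (if i = p then 1 else 0) * ((if j = q then 1 else 0) * G i j) := by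
    rw [← hθ, ← hθ]; rfl
  simp only [tensorSum, evalTwo_sum, h]
  simp

theorem IsDual.evalTwo_apply_eq_sum (t : BalTensor k A (OneForms k A) (OneForms k A))
    (X Y : Der k A) : evalTwo k A t X Y =
      ∑ i, ∑ j, θ i X * θ j Y * evalTwo k A t (b i) (b j) := by
  induction t using BalTensor.induction with
  | h0 => simp [evalTwo_zero]
  | htmul α β =>
    simp only [evalTwo_btmul]
    rw [hθ.apply_eq_sum α, hθ.apply_eq_sum β, Finset.sum_mul_sum]
    refine Finset.sum_congr rfl fun i _ => Finset.sum_congr rfl fun j _ => ?_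
    rw [mul_assoc, mul_assoc, ← mul_assoc (α (b i)), hθ.commute_apply j Y (α (b i)), mul_assoc]
  | hadd s t hs ht => simp only [evalTwo_add, mul_add, Finset.sum_add_distrib, hs, ht]

theorem IsDual.eq_tensorSum (t : BalTensor k A (OneForms k A) (OneForms k A)) :
    t = tensorSum θ fun i j => evalTwo k A t (b i) (b j) := by
  have hsum {κ : Type _} (s : Finset κ) (f : κ → OneForms k A) (ρ : OneForms k A) :
      btmul k A (∑ i ∈ s, f i) ρ = ∑ i ∈ s, btmul k A (f i) ρ :=
    map_sum (⟨⟨fun ζ => btmul k A ζ ρ, btmul_zero_left k A _ _ ρ⟩,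
      fun ζ ζ' => btmul_add_left k A _ _ ζ ζ' ρ⟩ : OneForms k A →+ _) f s
  have hsum' {κ : Type _} (s : Finset κ) (f : κ → OneForms k A) (ζ : OneForms k A) :
      btmul k A ζ (∑ i ∈ s, f i) = ∑ i ∈ s, btmul k A ζ (f i) :=
    map_sum (⟨⟨fun ρ => btmul k A ζ ρ, btmul_zero_right k A _ _ ζ⟩,
      fun ρ ρ' => btmul_add_right k A _ _ ζ ρ ρ'⟩ : OneForms k A →+ _) f s
  induction t using BalTensor.induction with
  | h0 => simp [tensorSum, evalTwo_zero, btmul_zero_right]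
  | htmul α β =>
    conv_lhs => rw [hθ.eq_sum_op_smul α, hsum]
    refine Finset.sum_congr rfl fun i _ => ?_
    rw [btmul_balanced]
    conv_lhs => rw [hθ.eq_sum_smul β, Finset.smul_sum, hsum']
    refine Finset.sum_congr rfl fun j _ => ?_
    rw [smul_smul, hθ.smul_eq_op_smul]
    rfl
  | hadd s t hs ht =>
    conv_lhs => rw [hs, ht]
    simp only [tensorSum, evalTwo_add, MulOpposite.op_add, add_smul, btmul_add_right,
      Finset.sum_add_distrib]

/-- Two-tensors are determined by their values on the basis derivations. -/
theorem IsDual.tensor_ext {s t : BalTensor k A (OneForms k A) (OneForms k A)}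
    (h : ∀ i j, evalTwo k A s (b i) (b j) = evalTwo k A t (b i) (b j)) : s = t := by
  rw [hθ.eq_tensorSum s, hθ.eq_tensorSum t]
  simp only [h]

theorem IsDual.evalTwo_injective : Function.Injective (evalTwo k A) :=
  fun _ _ h => hθ.tensor_ext fun i j => congrFun (congrFun h (b i)) (b j)

theorem IsDual.exists_flip (t : BalTensor k A (OneForms k A) (OneForms k A)) :
    ∃ s, ∀ X Y, evalTwo k A s X Y = evalTwo k A t Y X := by
  refine ⟨tensorSum θ fun i j => evalTwo k A t (b j) (b i), fun X Y => ?_⟩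
  rw [hθ.evalTwo_apply_eq_sum, hθ.evalTwo_apply_eq_sum t, Finset.sum_comm]
  refine Finset.sum_congr rfl fun i _ => Finset.sum_congr rfl fun j _ => ?_
  rw [hθ.evalTwo_tensorSum_basis, hθ.commute_apply i Y]

/-- The interchange of the two arguments of a two-tensor is a bimodule automorphism, and is
determined by its effect on values. -/
theorem IsDual.existsUnique_isFlip : ∃! σ : FormsIso k A, IsFlip k A σ := by
  choose f hf using hθ.exists_flip
  have hinj := hθ.evalTwo_injective
  have hff (t) : f (f t) = t := hinj (funext fun X => funext fun Y => by rw [hf, hf])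
  have hadd (s t) : f (s + t) = f s + f t :=
    hinj (funext fun X => funext fun Y => by rw [hf, evalTwo_add, evalTwo_add, hf, hf])
  have hscalar (c : k) (t) : f (c • t) = c • f t :=
    hinj (funext fun X => funext fun Y => by
      rw [hf, evalTwo_scalar_smul, evalTwo_scalar_smul, hf])
  have hleft (a : A) (t) : f (a • t) = a • f t :=
    hinj (funext fun X => funext fun Y => by rw [hf, evalTwo_smul, evalTwo_smul, hf])
  have hright (a : A) (t) : f (op a • t) = op a • f t :=
    hinj (funext fun X => funext fun Y => by rw [hf, evalTwo_op_smul, evalTwo_op_smul, hf])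
  let e : BalTensor k A (OneForms k A) (OneForms k A) ≃ₗ[k]
      BalTensor k A (OneForms k A) (OneForms k A) :=
    { toFun := f, invFun := f, left_inv := hff, right_inv := hff, map_add' := hadd,
      map_smul' := hscalar }
  refine ⟨⟨e, hleft, hright⟩, hf, fun τ hτ => ?_⟩
  obtain ⟨τ', h1, h2⟩ := τ
  have he : τ' = e := LinearEquiv.ext fun t => hinj (funext fun X => funext fun Y =>
    (hτ t X Y).trans (hf t X Y).symm)
  subst he
  rfl

/-! ### Connections and their Christoffel symbols -/

theorem IsDual.existsUnique_family_tensorSum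
    (T : ι → BalTensor k A (OneForms k A) (OneForms k A)) :
    ∃! Γ : ι → ι → ι → A, ∀ i, T i = tensorSum θ (Γ i) :=
  ⟨fun i p q => evalTwo k A (T i) (b p) (b q), fun i => hθ.eq_tensorSum (T i), fun Γ hΓ =>
    funext fun i => funext fun p => funext fun q => by
      rw [hΓ i, hθ.evalTwo_tensorSum_basis]⟩

theorem IsDual.evalTwo_leftConn {L : LeftConn k A} {Γ : ι → ι → ι → A}
    (hΓ : IsLeftChristoffel θ L Γ) (ζ : OneForms k A) (p q : ι) :
    evalTwo k A (L.toLinearMap ζ) (b p) (b q) =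
      (b p).1 (ζ (b q)) + ∑ i, ζ (b i) * Γ i p q := by
  conv_lhs => rw [hθ.eq_sum_smul ζ]
  have h (i : ι) : evalTwo k A (L.toLinearMap (ζ (b i) • θ i)) (b p) (b q) =
      (b p).1 (ζ (b i)) * (if i = q then 1 else 0) + ζ (b i) * Γ i p q := by
    rw [L.leibniz, evalTwo_add, evalTwo_smul, hΓ i, hθ.evalTwo_tensorSum_basis, evalTwo_btmul, hθ]
    rfl
  rw [map_sum, evalTwo_sum]
  simp only [h, Finset.sum_add_distrib]
  simp

theorem IsDual.evalTwo_rightConn {R : RightConn k A} {Γ : ι → ι → ι → A}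
    (hΓ : IsRightChristoffel θ R Γ) (ζ : OneForms k A) (p q : ι) :
    evalTwo k A (R.toLinearMap ζ) (b p) (b q) =
      (b q).1 (ζ (b p)) + ∑ i, Γ i p q * ζ (b i) := by
  conv_lhs => rw [hθ.eq_sum_op_smul ζ]
  have h (i : ι) : evalTwo k A (R.toLinearMap (op (ζ (b i)) • θ i)) (b p) (b q) =
      (if i = p then 1 else 0) * (b q).1 (ζ (b i)) + Γ i p q * ζ (b i) := by
    rw [R.leibniz, evalTwo_add, evalTwo_op_smul, hΓ i, hθ.evalTwo_tensorSum_basis, evalTwo_btmul,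
      hθ, add_comm]
    rfl
  rw [map_sum, evalTwo_sum]
  simp only [h, Finset.sum_add_distrib]
  simp

variable {σ : FormsIso k A} (hσ : IsFlip k A σ) {L : LeftConn k A} {R : RightConn k A}
  {Γ Γ' : ι → ι → ι → A} (hL : IsLeftChristoffel θ L Γ) (hR : IsRightChristoffel θ R Γ')
include hσ hL hR

/-- In coordinates the derivative terms of `∇ᴸ ζ` and `σ (∇ᴿ ζ)` agree, whatever `ζ` is, and only
the Christoffel terms are left to compare. -/
theorem IsDual.leftConn_eq_flip_rightConn_iff (ζ : OneForms k A) :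
    L.toLinearMap ζ = σ.toEquiv (R.toLinearMap ζ) ↔
      ∀ p q, ∑ i, ζ (b i) * Γ i p q = ∑ i, Γ' i q p * ζ (b i) := by
  have h (p q : ι) : evalTwo k A (L.toLinearMap ζ) (b p) (b q) =
      evalTwo k A (σ.toEquiv (R.toLinearMap ζ)) (b p) (b q) ↔
        ∑ i, ζ (b i) * Γ i p q = ∑ i, Γ' i q p * ζ (b i) := by
    rw [hσ, hθ.evalTwo_leftConn hL, hθ.evalTwo_rightConn hR, add_right_inj]
  exact ⟨fun h' p q => (h p q).1 (by rw [h']),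
    fun h' => hθ.tensor_ext fun p q => (h p q).2 (h' p q)⟩

theorem IsDual.leftConn_eq_flip_rightConn_smul_iff (a : A) (i : ι) :
    L.toLinearMap (a • θ i) = σ.toEquiv (R.toLinearMap (a • θ i)) ↔
      ∀ p q, a * Γ i p q = Γ' i q p * a := by
  rw [hθ.leftConn_eq_flip_rightConn_iff hσ hL hR]
  have h (j : ι) : (a • θ i) (b j) = if i = j then a else 0 := by
    rw [LinearMap.smul_apply, hθ, smul_eq_mul, mul_ite, mul_one, mul_zero]
  simp [h]

theorem IsDual.isSigmaCompatible_iff :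
    IsSigmaCompatible σ L R ↔ ∀ i p q, Γ' i q p = Γ i p q := by
  refine ⟨fun h i p q => ?_, fun h ζ hζ => ?_⟩
  · have h1 := (hθ.leftConn_eq_flip_rightConn_smul_iff hσ hL hR 1 i).1
      (by rw [one_smul]; exact h _ fun a => hθ.smul_eq_op_smul a i) p q
    rw [one_mul, mul_one] at h1
    exact h1.symm
  · refine (hθ.leftConn_eq_flip_rightConn_iff hσ hL hR ζ).2 fun p q =>
      Finset.sum_congr rfl fun i _ => ?_
    rw [h]
    exact (LinearMap.congr_fun (hζ (Γ i p q)) (b i)).symm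

theorem IsDual.isSigmaCompatibleOnWhole_iff :
    IsSigmaCompatibleOnWhole σ L R ↔
      ∀ i p q, Γ' i q p = Γ i p q ∧ ∀ a, a * Γ i p q = Γ i p q * a := by
  refine ⟨fun h i p q => ?_, fun h ζ => ?_⟩
  · have h1 := (hθ.isSigmaCompatible_iff hσ hL hR).1 (fun ζ _ => h ζ) i p q
    refine ⟨h1, fun a => ?_⟩
    rw [(hθ.leftConn_eq_flip_rightConn_smul_iff hσ hL hR a i).1 (h _) p q, h1]
  · refine (hθ.leftConn_eq_flip_rightConn_iff hσ hL hR ζ).2 fun p q =>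
      Finset.sum_congr rfl fun i _ => ?_
    rw [(h i p q).1, (h i p q).2]

omit hθ hσ hL hR in
/-- The statements about dual forms, the flip and the Christoffel symbols hold for every family
of derivations that is a basis of `Der A` over the centre of `A`. -/
theorem christoffel_of_basis {e : ι → Der k A} (hb : ⇑b = e) :
    (∃! θ : ι → OneForms k A, IsDual θ e) ∧ (∃! σ : FormsIso k A, IsFlip k A σ) ∧
    ∀ (θ : ι → OneForms k A) (σ : FormsIso k A), IsDual θ e → IsFlip k A σ →
      ∀ (L : LeftConn k A) (R : RightConn k A),
        (∃! Γ, IsLeftChristoffel θ L Γ) ∧ (∃! Γ', IsRightChristoffel θ R Γ') ∧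
        ∀ Γ Γ' : ι → ι → ι → A, IsLeftChristoffel θ L Γ → IsRightChristoffel θ R Γ' →
          (IsSigmaCompatible σ L R ↔ ∀ i j k, Γ' i k j = Γ i j k) ∧
          (IsSigmaCompatibleOnWhole σ L R ↔
            ∀ i j k, Γ' i k j = Γ i j k ∧ ∀ a, a * Γ i j k = Γ i j k * a) := by
  subst hb
  exact ⟨existsUnique_isDual b, (isDual_coordForm b).existsUnique_isFlip, fun θ σ hθ hσ L R =>
    ⟨hθ.existsUnique_family_tensorSum fun i => L.toLinearMap (θ i),
      hθ.existsUnique_family_tensorSum fun i => R.toLinearMap (θ i), fun Γ Γ' hL hR =>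
        ⟨hθ.isSigmaCompatible_iff hσ hL hR, hθ.isSigmaCompatibleOnWhole_iff hσ hL hR⟩⟩⟩

end FreeDerivations

end MatrixGeometry
end

open MatrixGeometry in
open scoped Manifold ContDiff in
theorem proposition2p2 (m n : ℕ) (hn : 1 ≤ n)
    (M : Type*) [TopologicalSpace M] [T2Space M] [SigmaCompactSpace M]
    [ChartedSpace (EuclideanSpace ℝ (Fin m)) M] [IsManifold (𝓡 m) ∞ M]
    (V : Fin m → (x : M) → TangentSpace (𝓡 m) x)
    (hV : IsLocalFrameOn (𝓡 m) (EuclideanSpace ℝ (Fin m)) ∞ V Set.univ)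
    (Λ : Module.Basis (Fin (n ^ 2 - 1)) ℂ (LieAlgebra.SpecialLinear.sl (Fin n) ℂ)) :
    (∃! θ : Fin m ⊕ Fin (n ^ 2 - 1) → OneForms ℂ (MatFun m M n), IsDual θ (frame V hV Λ)) ∧
    (∃! σ : FormsIso ℂ (MatFun m M n), IsFlip ℂ (MatFun m M n) σ) ∧
    ∀ (θ : Fin m ⊕ Fin (n ^ 2 - 1) → OneForms ℂ (MatFun m M n))
      (σ : FormsIso ℂ (MatFun m M n)),
      IsDual θ (frame V hV Λ) → IsFlip ℂ (MatFun m M n) σ →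
      ∀ (L : LeftConn ℂ (MatFun m M n)) (R : RightConn ℂ (MatFun m M n)),
        (∃! Γ, IsLeftChristoffel θ L Γ) ∧ (∃! Γ', IsRightChristoffel θ R Γ') ∧
        ∀ Γ Γ' : Fin m ⊕ Fin (n ^ 2 - 1) → Fin m ⊕ Fin (n ^ 2 - 1) →
            Fin m ⊕ Fin (n ^ 2 - 1) → MatFun m M n,
          IsLeftChristoffel θ L Γ → IsRightChristoffel θ R Γ' →
          (IsSigmaCompatible σ L R ↔ ∀ i j k, Γ' i k j = Γ i j k) ∧
          (IsSigmaCompatibleOnWhole σ L R ↔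
            ∀ i j k, Γ' i k j = Γ i j k ∧
              ∃ f : Smooth m M, Γ i j k = algebraMap (Smooth m M) (MatFun m M n) f) := by
  have : NeZero n := ⟨Nat.one_le_iff_ne_zero.1 hn⟩
  have hcentre (z : MatFun m M n) : (∀ a, a * z = z * a) ↔
      ∃ f : Smooth m M, z = algebraMap (Smooth m M) (MatFun m M n) f :=
    ⟨exists_eq_algebraMap_of_commute, by rintro ⟨f, rfl⟩ a; exact (Algebra.commutes f a).symm⟩
  simp only [← hcentre]
  exact christoffel_of_basis (funext (frameBasis_apply hV Λ))
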